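/- Let $\Sigma$ be a finite alphabet and $I\subseteq\Sigma\times\Sigma$ an irreflexive and symmetric relation, and let $\mathcal{M}=\mathcal{M}(\Sigma,I)=\langle\Sigma\mid ab=ba\ \ \forall (a,b)\in I\rangle$ be the corresponding trace monoid. The length $|x|$ of a trace $x\in\mathcal{M}$ is the length of any word representing it, and a clique is a trace that is a product $a_1\cdots a_p$ ($p\ge 0$) of letters with $(a_i,a_j)\in I$ for all $i\neq j$. The Möbius polynomial of $\mathcal{M}$ is $\mu(z)=\sum_{c}(-1)^{|c|}z^{|c|}$, the sum being over all cliques $c$. A concurrent system $(\mathcal{M},X,\bot)$ consists of a finite set $X$ of states, a symbol $\bot\notin X$ and a right action of $\mathcal{M}$ on $X\cup\{\bot\}$ that fixes $\bot$. Its characteristic root is the minimum over $(\alpha,\beta)\in X\times X$ of the radii of convergence in $[0,+\infty]$ of the series $\sum_{n\ge 0}\#\{x\in\mathcal{M}: |x|=n,\ \alpha\cdot x=\beta\}\,z^n$. It has the spectral property if, for every letter $a\in\Sigma$, the characteristic root of the system $(\mathcal{M}^a,X,\bot)$ obtained by restricting the action to the submonoid $\mathcal{M}^a=\langle\Sigma\setminus\{a\}\rangle$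 is strictly larger than that of $(\mathcal{M},X,\bot)$. The characteristic root $r$ and the spectral property of the trace monoid $\mathcal{M}$ are those of the concurrent system with a single state $*$ such that $*\cdot x=*$ for all $x\in\mathcal{M}$; in particular $r$ is the radius of convergence of $\sum_{n\ge0}\#\{x\in\mathcal{M}:|x|=n\}z^n$. The trace monoid $\mathcal{M}$ is irreducible if the graph $(\Sigma,D)$ with $D=(\Sigma\times\Sigma)\setminus I$ is connected (the empty graph counting as connected). **Proposition.** 1. Let $\widetilde\Sigma\subseteq\Sigma$, and let $\widetilde r$ and $\widetilde\mu(z)$ be the characteristic root and the Möbius polynomial of the trace monoid $\widetilde{\mathcal{M}}=\langle\widetilde\Sigma\rangle=\mathcal{M}(\widetilde\Sigma,I\cap(\widetilde\Sigma\times\widetilde\Sigma))$. Then $r\le\widetilde r$. Furthermore, if $\Sigma\neq\emptyset$, then $r<\infty$, and $r<\widetilde r$ if and only if $\widetilde\mu(r)>0$. 2. $\mathcal{M}$ has the spectral property if and only if $\mathcal{M}$ is irreducible. -/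

import Mathlib

/-- The defining relations `ab = ba`, for `(a, b)` in the independence relation. An irreflexive and
symmetric relation on the alphabet `A` is the same thing as a `SimpleGraph A`. -/
inductive TraceMonoid.Rel {A : Type*} (I : SimpleGraph A) : FreeMonoid A → FreeMonoid A → Prop
  | comm (a b : A) (h : I.Adj a b) :
      TraceMonoid.Rel I (FreeMonoid.of a * FreeMonoid.of b) (FreeMonoid.of b * FreeMonoid.of a)

/-- The trace monoid `⟨A | ab = ba for all (a, b) ∈ I⟩`. -/
abbrev TraceMonoid {A : Type*} (I : SimpleGraph A) : Type _ :=
  PresentedMonoid (TraceMonoid.Rel I)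

namespace TraceMonoid

/-- The image of a letter in the trace monoid. -/
def letter {A : Type*} (I : SimpleGraph A) (a : A) : TraceMonoid I :=
  PresentedMonoid.of (Rel I) a

theorem letter_comm {A : Type*} {I : SimpleGraph A} {a b : A} (h : I.Adj a b) :
    letter I a * letter I b = letter I b * letter I a :=
  PresentedMonoid.mk_eq_mk_of_rel (Rel.comm a b h)

/-- The length as a monoid morphism: every letter has length one. -/
def lengthHom {A : Type*} (I : SimpleGraph A) : TraceMonoid I →* Multiplicative ℕ :=
  PresentedMonoid.lift (fun _ => Multiplicative.ofAdd 1) (by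
    rintro _ _ ⟨a, b, h⟩
    simp)

/-- The length `|x|` of a trace `x`. -/
def length {A : Type*} {I : SimpleGraph A} (x : TraceMonoid I) : ℕ :=
  Multiplicative.toAdd (lengthHom I x)

/-- The length of a trace is the length of any word representing it. -/
theorem length_prod {A : Type*} (I : SimpleGraph A) (l : List A) :
    length ((l.map (letter I)).prod) = l.length := by
  induction l with
  | nil => simp [length]
  | cons a l ih =>
    have h : lengthHom I (letter I a) = Multiplicative.ofAdd 1 := rfl
    simp only [length, List.map_cons, List.prod_cons, map_mul, toAdd_mul, h, toAdd_ofAdd] at ih ⊢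
    rw [ih, List.length_cons, add_comm]

/-- The set of cliques: the traces that are products of pairwise independent letters. -/
def cliques {A : Type*} (I : SimpleGraph A) : Set (TraceMonoid I) :=
  {x | ∃ l : List A, l.Pairwise I.Adj ∧ x = (l.map (letter I)).prod}

theorem cliques_finite {A : Type*} [Finite A] (I : SimpleGraph A) : (cliques I).Finite := by
  have := Fintype.ofFinite A
  have h : {l : List A | l.Nodup}.Finite :=
    (List.finite_length_le A (Fintype.card A)).subset fun l hl =>
      List.Nodup.length_le_card hl
  refine (h.image fun l => (l.map (letter I)).prod).subset ?_
  rintro x ⟨l, hl, rfl⟩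
  exact ⟨l, hl.imp fun h => h.ne, rfl⟩

/-- The Möbius polynomial `∑_c (-1)^|c| z^|c|`, the sum ranging over the (finitely many) cliques. -/
noncomputable def moebius {A : Type*} (I : SimpleGraph A) : Polynomial ℝ :=
  ∑ᶠ c ∈ cliques I, (-1 : Polynomial ℝ) ^ length c * Polynomial.X ^ length c

/-- A trace monoid is irreducible if its Coxeter graph, the graph of the dependence relation
`D = (A × A) \ I`, is connected (loops are irrelevant; the empty graph counts as connected). -/
def IsIrreducible {A : Type*} (I : SimpleGraph A) : Prop :=
  Iᶜ.Preconnected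

/-- The canonical morphism from the trace monoid `M(H, I_H)` with `I_H = (H × H) ∩ I`
to `M(A, I)`, for a set `H` of letters. -/
def incl {A : Type*} (I : SimpleGraph A) (H : Set A) : TraceMonoid (I.induce H) →* TraceMonoid I :=
  PresentedMonoid.lift (fun a : H => letter I a) (by
    rintro _ _ ⟨a, b, h⟩
    simpa using letter_comm (I := I) h)

/-- `M(H, I_H)` is identified with a submonoid of `M(A, I)`. -/
theorem incl_injective {A : Type*} (I : SimpleGraph A) (H : Set A) :
    Function.Injective (incl I H) := by
  classical
  let f : A → TraceMonoid (I.induce H) :=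
    fun a => if h : a ∈ H then letter (I.induce H) ⟨a, h⟩ else 1
  have hf : ∀ u v : FreeMonoid A, Rel I u v → FreeMonoid.lift f u = FreeMonoid.lift f v := by
    rintro _ _ ⟨a, b, h⟩
    rw [map_mul, map_mul, FreeMonoid.lift_eval_of, FreeMonoid.lift_eval_of]
    simp only [f]
    split_ifs with ha hb
    · exact letter_comm (I := I.induce H) (a := ⟨_, ha⟩) (b := ⟨_, hb⟩) h
    all_goals simp
  have key : (PresentedMonoid.lift (rels := Rel I) f hf).comp (incl I H)
      = MonoidHom.id (TraceMonoid (I.induce H)) := by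
    refine PresentedMonoid.ext _ fun a => ?_
    change f a = letter (I.induce H) a
    simp [f]
  exact Function.LeftInverse.injective fun x => DFunLike.congr_fun key x

/-- This submonoid is the submonoid `⟨H⟩` generated by `H`. -/
theorem mrange_incl {A : Type*} (I : SimpleGraph A) (H : Set A) :
    MonoidHom.mrange (incl I H) = Submonoid.closure (letter I '' H) := by
  rw [MonoidHom.mrange_eq_map, ← PresentedMonoid.closure_range_of, MonoidHom.map_mclosure,
    ← Set.range_comp]
  congr 1
  ext x
  constructor
  · rintro ⟨a, rfl⟩
    exact ⟨a, a.2, rfl⟩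
  · rintro ⟨a, ha, rfl⟩
    exact ⟨⟨a, ha⟩, rfl⟩

end TraceMonoid

/-- A concurrent system `(M, X, ⊥)` over the trace monoid `M = M(A, I)`: a right action of `M` on
`X ∪ {⊥}`, here `Option X` with `⊥ = none`, that fixes `⊥`, the set `X` of states being finite. -/
structure ConcurrentSystem {A : Type*} (I : SimpleGraph A) (X : Type*) where
  finite_states : Finite X
  act : Option X → TraceMonoid I → Option X
  act_one : ∀ s, act s 1 = s
  act_mul : ∀ s x y, act s (x * y) = act (act s x) y
  act_bot : ∀ x, act none x = none

namespace ConcurrentSystem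

/-- The set `M_{α,β}(n)` of executions of length `n` that lead from `α` to `β`. -/
def executions {A X : Type*} {I : SimpleGraph A} (S : ConcurrentSystem I X) (α β : X) (n : ℕ) :
    Set (TraceMonoid I) :=
  {x | S.act (some α) x = some β ∧ TraceMonoid.length x = n}

theorem executions_finite {A X : Type*} [Finite A] {I : SimpleGraph A} (S : ConcurrentSystem I X)
    (α β : X) (n : ℕ) : (S.executions α β n).Finite := by
  refine ((List.finite_length_eq A n).image
    fun l => (l.map (TraceMonoid.letter I)).prod).subset ?_
  rintro x ⟨-, hx⟩
  obtain ⟨w, rfl⟩ := PresentedMonoid.surjective_mk x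
  have hw : PresentedMonoid.mk (TraceMonoid.Rel I) w
      = (w.toList.map (TraceMonoid.letter I)).prod := by
    clear hx
    induction w with
    | one => rfl
    | of a => simp [TraceMonoid.letter, PresentedMonoid.of]
    | mul u v hu hv => simp_all
  rw [hw, TraceMonoid.length_prod] at hx
  exact ⟨w.toList, hx, hw.symm⟩

/-- The radius of convergence of the growth series `G_{α,β}(z) = ∑ₙ #M_{α,β}(n) zⁿ`. -/
noncomputable def growthRadius {A X : Type*} {I : SimpleGraph A} (S : ConcurrentSystem I X)
    (α β : X) : ENNReal :=
  (FormalMultilinearSeries.ofScalars ℝ fun n => ((S.executions α β n).ncard : ℝ)).radius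

/-- The characteristic root of a concurrent system: the minimum of the radii of convergence
of its growth series, possibly infinite. -/
noncomputable def charRoot {A X : Type*} {I : SimpleGraph A} (S : ConcurrentSystem I X) : ENNReal :=
  ⨅ (α : X) (β : X), S.growthRadius α β

/-- The restriction of a concurrent system to the submonoid generated by a set `H` of letters. -/
def restrict {A X : Type*} {I : SimpleGraph A} (S : ConcurrentSystem I X) (H : Set A) :
    ConcurrentSystem (I.induce H) X where
  finite_states := S.finite_states
  act s x := S.act s (TraceMonoid.incl I H x)
  act_one s := by rw [map_one, S.act_one]
  act_mul s x y := by rw [map_mul, S.act_mul]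
  act_bot x := S.act_bot _

/-- The spectral property: for every letter `a`, restricting the system to the submonoid generated
by the letters other than `a` increases the characteristic root strictly. -/
def SpectralProperty {A X : Type*} {I : SimpleGraph A} (S : ConcurrentSystem I X) : Prop :=
  ∀ a : A, S.charRoot < (S.restrict {b | b ≠ a}).charRoot

end ConcurrentSystem

namespace TraceMonoid

/-- The concurrent system canonically associated with a trace monoid: it has a single state, which
every trace fixes. -/
def toSystem {A : Type*} (I : SimpleGraph A) : ConcurrentSystem I Unit where
  finite_states := inferInstance
  act s _ := s
  act_one _ := rfl
  act_mul _ _ _ := rfl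
  act_bot _ := rfl

/-- The characteristic root of a trace monoid. -/
noncomputable def charRoot {A : Type*} (I : SimpleGraph A) : ENNReal :=
  (toSystem I).charRoot

end TraceMonoid

/-! Everything rests on the identity `G(z) μ(z) = 1` for the growth series `G`. A finite set `C` of
letters consists of possible first letters of a trace `x` exactly when `C` is a clique dividing `x`
on the left (`subset_minLetters_iff`). For `x ≠ 1` the alternating sum over the subsets of its
nonempty set of first letters vanishes, which gives the identity coefficient by coefficient
(`growth_mul_moebius`).

As `G` has nonnegative coefficients, `μ` is positive on `[0, r)`, and a Pringsheim argument shows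
that a finite radius `r` is a root of `μ` (`eval_radius_eq_zero`). Traces over a sub-alphabet are
traces over the whole one, so `r ≤ r̃`; hence `μ̃(r)` is positive if `r < r̃` and zero if `r = r̃`,
which is part 1.

For part 2, write `μ_s` for the Möbius polynomial of the sub-alphabet `s`; always `μ_s(r) ≥ 0`. Let
`s` be minimal with `μ_s(r) = 0`. For `b ∉ s`, the recursion `μ_{s ∪ {b}} = μ_s - z μ_{s ∩ I(b)}`
forces `μ_{s ∩ I(b)}(r) = 0`, so `s ⊆ I(b)` by minimality. Thus no dependence edge leaves `s`, and
irreducibility forces `s` to be the whole alphabet. Conversely, a disconnected dependence graph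
splits `μ` into two factors over proper sub-alphabets, one of which vanishes at `r`; this
contradicts the spectral property. -/

namespace TraceMonoid

/-! ### Left division by letters and cancellation -/

section Division

variable {A : Type*} {I : SimpleGraph A}

@[simp]
theorem length_one : length (1 : TraceMonoid I) = 0 := by
  simp [length]

@[simp]
theorem length_mul (x y : TraceMonoid I) : length (x * y) = length x + length y := by
  simp [length]

@[simp]
theorem length_letter (a : A) : length (letter I a) = 1 := rfl

theorem exists_list_prod_eq (x : TraceMonoid I) : ∃ l : List A, (l.map (letter I)).prod = x := by
  obtain ⟨w, rfl⟩ := PresentedMonoid.surjective_mk x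
  induction w with
  | one => exact ⟨[], rfl⟩
  | of a => exact ⟨[a], by simp [letter, PresentedMonoid.of]⟩
  | mul u v hu hv =>
    obtain ⟨l, hl⟩ := hu
    obtain ⟨m, hm⟩ := hv
    exact ⟨l ++ m, by simp [hl, hm]⟩

theorem letter_mul_induction {p : TraceMonoid I → Prop} (one : p 1)
    (mul : ∀ a x, p x → p (letter I a * x)) (x : TraceMonoid I) : p x := by
  obtain ⟨l, rfl⟩ := exists_list_prod_eq x
  induction l with
  | nil => exact one
  | cons a l ih => simpa using mul a _ ih

theorem eq_one_of_length_eq_zero {x : TraceMonoid I} (h : length x = 0) : x = 1 := by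
  obtain ⟨l, rfl⟩ := exists_list_prod_eq x
  rw [length_prod, List.length_eq_zero_iff] at h
  simp [h]

open Classical in
/-- One step of the division by the letter `a`: a letter `b` sends a trace `x`, together with the
quotient of `x` by `a` (if any), to `b * x` together with the quotient of `b * x` by `a`. -/
noncomputable def leftDivStep (I : SimpleGraph A) (a b : A) :
    Function.End (TraceMonoid I × Option (TraceMonoid I)) :=
  fun p => (letter I b * p.1,
    -- An independent `b` lets `a` pass to the front, a dependent `b ≠ a` blocks it. The case `b =
    -- a` is why the trace itself must be carried along.
    if b = a then some p.1 else if I.Adj a b then p.2.map (letter I b * ·) else none)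

/-- The action of traces that results from `leftDivStep`. -/
noncomputable def leftDivHom (I : SimpleGraph A) (a : A) :
    TraceMonoid I →* Function.End (TraceMonoid I × Option (TraceMonoid I)) :=
  PresentedMonoid.lift (leftDivStep I a) (by
    rintro _ _ ⟨b, c, h⟩
    have hc (x : TraceMonoid I) : letter I b * (letter I c * x) = letter I c * (letter I b * x) := by
      rw [← mul_assoc, letter_comm h, mul_assoc]
    have hne := h.ne
    rw [map_mul, map_mul, FreeMonoid.lift_eval_of, FreeMonoid.lift_eval_of]
    funext ⟨x, d⟩
    change leftDivStep I a b (leftDivStep I a c (x, d))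
      = leftDivStep I a c (leftDivStep I a b (x, d))
    by_cases hb : b = a
    · subst hb
      simp [leftDivStep, hc, h, hne.symm]
    by_cases hca : c = a
    · subst hca
      simp [leftDivStep, hc, h.symm, hne]
    by_cases h1 : I.Adj a b <;> by_cases h2 : I.Adj a c <;>
      simp [leftDivStep, hb, hca, h1, h2, hc, Function.comp_def])

/-- The quotient of a trace by a letter on the left, if there is one. -/
noncomputable def leftDiv (a : A) (x : TraceMonoid I) : Option (TraceMonoid I) :=
  (leftDivHom I a x (1, none)).2

theorem leftDivHom_letter_mul (a b : A) (x : TraceMonoid I) (p) :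
    leftDivHom I a (letter I b * x) p = leftDivStep I a b (leftDivHom I a x p) := by
  rw [map_mul]
  rfl

theorem leftDivHom_fst (a : A) (x : TraceMonoid I) : (leftDivHom I a x (1, none)).1 = x := by
  induction x using letter_mul_induction with
  | one => rw [map_one]; rfl
  | mul b x ih => rw [leftDivHom_letter_mul, leftDivStep, ih]

@[simp]
theorem leftDiv_one (a : A) : leftDiv a (1 : TraceMonoid I) = none := by
  rw [leftDiv, map_one]
  rfl

@[simp]
theorem leftDiv_letter_mul_self (a : A) (x : TraceMonoid I) :
    leftDiv a (letter I a * x) = some x := by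
  rw [leftDiv, leftDivHom_letter_mul, leftDivStep, leftDivHom_fst, if_pos rfl]

theorem leftDiv_letter_mul_of_adj {a b : A} (h : I.Adj a b) (x : TraceMonoid I) :
    leftDiv a (letter I b * x) = (leftDiv a x).map (letter I b * ·) := by
  rw [leftDiv, leftDivHom_letter_mul, leftDivStep, if_neg h.ne', if_pos h]
  rfl

theorem leftDiv_letter_mul_of_not_adj {a b : A} (hne : b ≠ a) (h : ¬ I.Adj a b)
    (x : TraceMonoid I) : leftDiv a (letter I b * x) = none := by
  rw [leftDiv, leftDivHom_letter_mul, leftDivStep, if_neg hne, if_neg h]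

theorem letter_mul_of_leftDiv_eq_some {a : A} {x y : TraceMonoid I} (h : leftDiv a x = some y) :
    letter I a * y = x := by
  induction x using letter_mul_induction generalizing y with
  | one => simp at h
  | mul b x ih =>
    by_cases hb : b = a
    · subst hb
      simp_all
    by_cases hab : I.Adj a b
    · rw [leftDiv_letter_mul_of_adj hab, Option.map_eq_some_iff] at h
      obtain ⟨z, hz, rfl⟩ := h
      rw [← mul_assoc, letter_comm hab, mul_assoc, ih hz]
    · rw [leftDiv_letter_mul_of_not_adj hb hab] at h
      simp at h

theorem letter_mul_injective (a : A) : Function.Injective (letter I a * ·) := fun x y h => by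
  have h' := congrArg (leftDiv a) h
  simpa using h'

theorem prod_mul_injective (l : List A) :
    Function.Injective ((l.map (letter I)).prod * ·) := by
  induction l with
  | nil => intro x y h; simpa using h
  | cons a l ih =>
    intro x y h
    simp only [List.map_cons, List.prod_cons, mul_assoc] at h
    exact ih (letter_mul_injective a h)

/-- The letters with which a word representing the trace can begin. -/
def minLetters (x : TraceMonoid I) : Set A :=
  {a | (leftDiv a x).isSome}

theorem minLetters_nonempty {x : TraceMonoid I} (h : length x ≠ 0) : (minLetters x).Nonempty := by
  induction x using letter_mul_induction with
  | one => simp at h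
  | mul a x _ => exact ⟨a, by simp [minLetters]⟩

theorem adj_of_mem_minLetters_letter_mul {a b : A} {x : TraceMonoid I} (hne : b ≠ a)
    (h : a ∈ minLetters (letter I b * x)) : I.Adj a b ∧ a ∈ minLetters x := by
  by_cases hab : I.Adj a b
  · refine ⟨hab, ?_⟩
    simpa [minLetters, leftDiv_letter_mul_of_adj hab] using h
  · simp [minLetters, leftDiv_letter_mul_of_not_adj hne hab] at h

/-- Divide by the letters one at a time: each remaining letter had to pass the one removed, so it is
independent of it and still a first letter of the quotient. -/
theorem exists_prod_mul_of_subset_minLetters {l : List A} (hl : l.Nodup) {x : TraceMonoid I}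
    (h : ∀ a ∈ l, a ∈ minLetters x) :
    l.Pairwise I.Adj ∧ ∃ y, (l.map (letter I)).prod * y = x := by
  induction l generalizing x with
  | nil => simp
  | cons a l ih =>
    obtain ⟨y, hy⟩ := Option.isSome_iff_exists.1 (h a (by simp))
    have hyx := letter_mul_of_leftDiv_eq_some hy
    rw [List.nodup_cons] at hl
    have key (b) (hb : b ∈ l) : I.Adj b a ∧ b ∈ minLetters y :=
      adj_of_mem_minLetters_letter_mul (fun h => hl.1 (h ▸ hb))
        (by rw [hyx]; exact h b (by simp [hb]))
    obtain ⟨h1, z, hz⟩ := ih hl.2 fun b hb => (key b hb).2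
    refine ⟨List.pairwise_cons.2 ⟨fun b hb => (key b hb).1.symm, h1⟩, z, ?_⟩
    rw [List.map_cons, List.prod_cons, mul_assoc, hz, hyx]

theorem subset_minLetters_prod_mul {l : List A} (hl : l.Pairwise I.Adj) (x : TraceMonoid I) :
    ∀ a ∈ l, a ∈ minLetters ((l.map (letter I)).prod * x) := by
  induction l with
  | nil => simp
  | cons a l ih =>
    rw [List.pairwise_cons] at hl
    intro b hb
    rw [List.map_cons, List.prod_cons, mul_assoc]
    rcases List.mem_cons.1 hb with rfl | hb
    · simp [minLetters]
    · have := ih hl.2 b hb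
      simpa [minLetters, leftDiv_letter_mul_of_adj (hl.1 b hb).symm] using this

theorem mem_of_mem_minLetters_prod {l : List A} {a : A}
    (h : a ∈ minLetters ((l.map (letter I)).prod)) : a ∈ l := by
  induction l with
  | nil => simp [minLetters] at h
  | cons b l ih =>
    by_cases hb : b = a
    · simp [hb]
    · rw [List.map_cons, List.prod_cons] at h
      exact List.mem_cons_of_mem _ (ih (adj_of_mem_minLetters_letter_mul hb h).2)

end Division

/-! ### Cliques as finite sets of letters, and their polynomials -/

section Cliques

variable {A : Type*} (I : SimpleGraph A)

/-- The product, in some order, of the letters in a finite set. -/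
noncomputable def finsetProd (C : Finset A) : TraceMonoid I :=
  (C.toList.map (letter I)).prod

variable {I}

theorem length_finsetProd (C : Finset A) : length (finsetProd I C) = C.card := by
  rw [finsetProd, length_prod, Finset.length_toList]

theorem pairwise_toList_iff {C : Finset A} :
    C.toList.Pairwise I.Adj ↔ I.IsClique C := by
  have : Std.Symm I.Adj := ⟨fun _ _ h => h.symm⟩
  rw [← C.nodup_toList.pairwise_coe, SimpleGraph.isClique_iff]
  simp

theorem subset_minLetters_iff {C : Finset A} {x : TraceMonoid I} :
    (C : Set A) ⊆ minLetters x ↔ I.IsClique C ∧ ∃ y, finsetProd I C * y = x := by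
  rw [← pairwise_toList_iff]
  constructor
  · exact fun h => exists_prod_mul_of_subset_minLetters C.nodup_toList fun a ha => h (by simpa using ha)
  · rintro ⟨h, y, rfl⟩ a ha
    exact subset_minLetters_prod_mul h y a (by simpa using ha)

theorem minLetters_finsetProd {C : Finset A} (hC : I.IsClique C) :
    minLetters (finsetProd I C) = C := by
  refine subset_antisymm (fun a ha => by simpa using mem_of_mem_minLetters_prod ha) ?_
  exact subset_minLetters_iff.2 ⟨hC, 1, mul_one _⟩

theorem cliques_eq_image : cliques I = finsetProd I '' {C : Finset A | I.IsClique C} := by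
  classical
  ext x
  constructor
  · rintro ⟨l, hl, rfl⟩
    have hC : ((l.toFinset : Finset A) : Set A) ⊆ minLetters ((l.map (letter I)).prod) := by
      intro a ha
      have := subset_minLetters_prod_mul hl 1 a (by simpa using ha)
      rwa [mul_one] at this
    obtain ⟨h1, y, hy⟩ := subset_minLetters_iff.1 hC
    refine ⟨_, h1, ?_⟩
    -- The clique formed by the letters of `l` divides the product of `l` and has the same length,
    -- so the quotient is trivial.
    have hlen := congrArg length hy
    rw [length_mul, length_finsetProd, length_prod,
      List.toFinset_card_of_nodup (hl.imp fun h => h.ne)] at hlen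
    rw [← hy, eq_one_of_length_eq_zero (x := y) (by omega), mul_one]
  · rintro ⟨C, hC, rfl⟩
    exact ⟨C.toList, pairwise_toList_iff.2 hC, rfl⟩

open Polynomial in
open Classical in
/-- The alternating generating polynomial of the cliques contained in a finite set of letters. -/
noncomputable def cliquePoly (I : SimpleGraph A) (s : Finset A) : ℝ[X] :=
  ∑ C ∈ s.powerset.filter (fun C : Finset A => I.IsClique (C : Set A)), (-X) ^ C.card

theorem moebius_eq_cliquePoly [Fintype A] : moebius I = cliquePoly I Finset.univ := by
  classical
  rw [moebius, cliques_eq_image, finsum_mem_image, cliquePoly]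
  · rw [← finsum_mem_coe_finset]
    refine finsum_mem_congr (by ext; simp) fun C _ => ?_
    rw [length_finsetProd, ← mul_pow, neg_one_mul]
  -- A clique is recovered from its product as the set of first letters.
  · intro C hC D hD h
    have := minLetters_finsetProd hC
    rw [h, minLetters_finsetProd hD] at this
    exact_mod_cast this.symm

theorem moebius_induce (H : Set A) [Finite A] {s : Finset A} (hs : (s : Set A) = H) :
    moebius (I.induce H) = cliquePoly I s := by
  classical
  have := Fintype.ofFinite H
  rw [moebius_eq_cliquePoly, cliquePoly, cliquePoly]
  refine Finset.sum_bij' (fun C _ => C.map (Function.Embedding.subtype _))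
    (fun C _ => C.subtype (· ∈ H)) ?_ ?_ ?_ ?_ ?_
  · intro C hC
    simp only [Finset.powerset_univ, Finset.mem_filter, Finset.mem_univ, true_and,
      Finset.mem_powerset] at hC ⊢
    refine ⟨fun a ha => ?_, ?_⟩
    · obtain ⟨c, -, rfl⟩ := Finset.mem_map.1 ha
      rw [← Finset.mem_coe, hs]
      exact c.2
    · rw [Finset.coe_map]
      rintro _ ⟨a, ha, rfl⟩ _ ⟨b, hb, rfl⟩ hab
      exact hC ha hb fun h => hab (congrArg _ h)
  · intro C hC
    simp only [Finset.powerset_univ, Finset.mem_filter, Finset.mem_univ, true_and,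
      Finset.mem_powerset] at hC ⊢
    intro a ha b hb hab
    exact hC.2 (by simpa using ha) (by simpa using hb) fun h => hab (Subtype.ext h)
  · intro C hC
    ext
    simp
  · intro C hC
    simp only [Finset.mem_filter, Finset.mem_powerset] at hC
    refine Finset.subtype_map_of_mem fun a ha => ?_
    rw [← hs]
    exact hC.1 ha
  · simp

/-- Sort the cliques by whether they contain `b`: those that do are `b` together with a clique of
letters of `s` independent of `b`. -/
theorem cliquePoly_insert [DecidableEq A] [DecidableRel I.Adj] {b : A} {s : Finset A} (hb : b ∉ s) :
    cliquePoly I (insert b s)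
      = cliquePoly I s - Polynomial.X * cliquePoly I (s.filter (I.Adj b)) := by
  classical
  simp only [cliquePoly, Finset.sum_filter]
  rw [Finset.sum_powerset_insert hb, sub_eq_add_neg, Finset.mul_sum, ← Finset.sum_neg_distrib]
  congr 1
  have hcl (t : Finset A) (ht : t ∈ s.powerset) :
      I.IsClique ((insert b t : Finset A) : Set A) ↔
        I.IsClique (t : Set A) ∧ t ⊆ s.filter (I.Adj b) := by
    have hts := Finset.mem_powerset.1 ht
    rw [Finset.coe_insert, SimpleGraph.isClique_insert]
    refine and_congr_right fun _ => ⟨fun h c hc => ?_, fun h c hc _ => ?_⟩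
    · exact Finset.mem_filter.2 ⟨hts hc, h c hc fun h => hb (h ▸ hts hc)⟩
    · exact (Finset.mem_filter.1 (h hc)).2
  symm
  refine Finset.sum_subset_zero_on_sdiff (Finset.powerset_mono.2 (Finset.filter_subset _ _)) ?_ ?_
  · intro t ht
    rw [Finset.mem_sdiff] at ht
    exact if_neg fun h => ht.2 (Finset.mem_powerset.2 ((hcl t ht.1).1 h).2)
  · intro t ht
    have ht' := Finset.mem_powerset.1 ht
    have hts := Finset.powerset_mono.2 (Finset.filter_subset _ _) ht
    have hbt : b ∉ t := fun h => hb (Finset.mem_powerset.1 hts h)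
    simp only [hcl t hts, ht', and_true, Finset.card_insert_of_notMem hbt, pow_succ]
    split_ifs <;> ring

theorem cliquePoly_empty : cliquePoly I ∅ = 1 := by
  classical
  simp [cliquePoly, Finset.filter_singleton]

/-- Both sides obey the same recursion when a letter `b` is removed from `t`, since all of `s` is
independent of `b`. Strong induction is needed because the recursion also reaches the neighbours of
`b` in `t`. -/
theorem cliquePoly_union [DecidableEq A] {s t : Finset A} (h : ∀ a ∈ s, ∀ b ∈ t, I.Adj a b) :
    cliquePoly I (s ∪ t) = cliquePoly I s * cliquePoly I t := by
  classical
  induction t using Finset.strongInduction with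
  | H t ih =>
    rcases t.eq_empty_or_nonempty with rfl | ⟨b, hb⟩
    · simp [cliquePoly_empty]
    · have hst : b ∉ s := fun hs => (h b hs b hb).ne rfl
      obtain ⟨u, hu, rfl⟩ : ∃ u, b ∉ u ∧ insert b u = t :=
        ⟨t.erase b, by simp, Finset.insert_erase hb⟩
      have hsb : s.filter (I.Adj b) = s :=
        Finset.filter_true_of_mem fun a ha => (h a ha b hb).symm
      have hu' : u ⊂ insert b u := Finset.ssubset_insert hu
      rw [Finset.union_insert, cliquePoly_insert (by simp [hst, hu]), cliquePoly_insert hu,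
        Finset.filter_union, hsb, ih u hu' fun a ha c hc => h a ha c (hu'.1 hc),
        ih (u.filter (I.Adj b)) (lt_of_le_of_lt (Finset.filter_subset _ _) hu')
          fun a ha c hc => h a ha c (hu'.1 (Finset.filter_subset _ _ hc))]
      ring

end Cliques

/-! ### Counting traces: the growth series inverts the Möbius polynomial -/

section Growth

variable {A : Type*} (I : SimpleGraph A)

theorem finite_length_eq [Finite A] (n : ℕ) : {x : TraceMonoid I | length x = n}.Finite :=
  ((toSystem I).executions_finite () () n).subset fun _ hx => ⟨rfl, hx⟩

/-- The number of traces of length `n`. -/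
noncomputable def growth (n : ℕ) : ℕ := {x : TraceMonoid I | length x = n}.ncard

theorem growth_zero : growth I 0 = 1 := by
  rw [growth, Set.ncard_eq_one]
  exact ⟨1, Set.ext fun x => ⟨fun h => eq_one_of_length_eq_zero h, by rintro rfl; simp⟩⟩

/-- By left cancellation, multiplication by the clique is a bijection from all traces of length `n`
onto its multiples of length `C.card + n`. -/
theorem ncard_subset_minLetters {C : Finset A} (hC : I.IsClique (C : Set A)) (n : ℕ) :
    {x : TraceMonoid I | length x = C.card + n ∧ (C : Set A) ⊆ minLetters x}.ncard
      = growth I n := by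
  rw [growth, ← Set.ncard_image_of_injective {x : TraceMonoid I | length x = n}
    (prod_mul_injective C.toList)]
  congr 1
  ext x
  simp only [Set.mem_ofPred_eq, subset_minLetters_iff, Set.mem_image]
  constructor
  · rintro ⟨h, -, y, rfl⟩
    rw [length_mul, length_finsetProd] at h
    exact ⟨y, by omega, rfl⟩
  · rintro ⟨y, rfl, rfl⟩
    refine ⟨?_, hC, y, rfl⟩
    change length (finsetProd I C * y) = _
    rw [length_mul, length_finsetProd]

open Classical in
-- Count with signs the pairs of a trace `x` of length `n` and a set `C` of first letters of `x`.
-- For fixed `x` the sum is zero because `x ≠ 1` has a first letter; for fixed `C` it is the term in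
-- the statement.
theorem sum_clique_growth [Fintype A] {n : ℕ} (hn : n ≠ 0) :
    ∑ C ∈ Finset.univ.filter (fun C : Finset A => I.IsClique (C : Set A) ∧ C.card ≤ n),
      (-1 : ℝ) ^ C.card * growth I (n - C.card) = 0 := by
  let T := (finite_length_eq I n).toFinset
  have h1 (x : TraceMonoid I) (hx : x ∈ T) :
      ∑ C ∈ Finset.univ.filter (fun C : Finset A => (C : Set A) ⊆ minLetters x), (-1 : ℝ) ^ C.card = 0 := by
    have hx' : length x = n := by simpa [T] using hx
    have h := Finset.sum_powerset_neg_one_pow_card_of_nonempty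
      (x := (minLetters x).toFinite.toFinset)
      (by simpa using minLetters_nonempty (by omega : length x ≠ 0))
    have h' := congrArg (Int.cast : ℤ → ℝ) h
    push_cast at h'
    rw [← h']
    refine Finset.sum_congr ?_ fun _ _ => rfl
    ext C
    simp [← Finset.coe_subset]
  rw [← Finset.sum_eq_zero h1]
  simp_rw [Finset.sum_filter]
  rw [Finset.sum_comm]
  refine Finset.sum_congr rfl fun C _ => ?_
  rw [← Finset.sum_filter, Finset.sum_const, nsmul_eq_mul, mul_comm]
  split_ifs with hC
  · congr 2
    rw [← ncard_subset_minLetters I hC.1, Nat.add_sub_cancel' hC.2, ← Set.ncard_coe_finset]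
    congr 1
    ext
    simp [T]
  -- A set that is not a clique, or has more than `n` letters, divides no trace of length `n`.
  · suffices (T.filter fun x => (C : Set A) ⊆ minLetters x) = ∅ by simp [this]
    refine Finset.filter_eq_empty_iff.2 fun x hx hCx => hC ?_
    obtain ⟨h, y, rfl⟩ := subset_minLetters_iff.1 hCx
    have hx' : length (finsetProd I C * y) = n := by simpa [T] using hx
    rw [length_mul, length_finsetProd] at hx'
    exact ⟨h, by omega⟩

/-- The growth series of a trace monoid is the inverse of its Möbius polynomial. -/
theorem growth_mul_moebius [Finite A] :
    PowerSeries.mk (fun n => (growth I n : ℝ)) * (moebius I : PowerSeries ℝ) = 1 := by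
  classical
  have := Fintype.ofFinite A
  ext n
  rw [moebius_eq_cliquePoly, cliquePoly, ← Polynomial.coeToPowerSeries.ringHom_apply, map_sum,
    Finset.mul_sum, map_sum]
  have h (C : Finset A) : PowerSeries.coeff n (PowerSeries.mk (fun n => (growth I n : ℝ)) *
      Polynomial.coeToPowerSeries.ringHom ((-Polynomial.X : Polynomial ℝ) ^ C.card))
      = if C.card ≤ n then (-1 : ℝ) ^ C.card * growth I (n - C.card) else 0 := by
    have hX : Polynomial.coeToPowerSeries.ringHom ((-Polynomial.X : Polynomial ℝ) ^ C.card)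
        = PowerSeries.C ((-1 : ℝ) ^ C.card) * PowerSeries.X ^ C.card := by
      rw [map_pow, map_neg, neg_pow]
      simp
    rw [hX, mul_left_comm, PowerSeries.coeff_C_mul, PowerSeries.coeff_mul_X_pow', mul_ite, mul_zero,
      PowerSeries.coeff_mk]
  rw [Finset.sum_congr rfl fun C _ => h C, ← Finset.sum_filter, Finset.filter_filter,
    Finset.powerset_univ]
  rcases eq_or_ne n 0 with rfl | hn
  · rw [PowerSeries.coeff_zero_one, Finset.sum_eq_single ∅]
    · simp [growth_zero]
    · intro C hC hne
      simp_all
    · simp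
  · rw [sum_clique_growth I hn, PowerSeries.coeff_one, if_neg hn]

theorem growth_le [Fintype A] (n : ℕ) : growth I n ≤ Fintype.card A ^ n := by
  rw [← card_vector n, ← Nat.card_eq_fintype_card, growth, ← Set.ncard_univ]
  let f (v : List.Vector A n) : TraceMonoid I := (v.toList.map (letter I)).prod
  refine (Set.ncard_le_ncard ?_ (Set.finite_univ.image f)).trans (Set.ncard_image_le Set.finite_univ)
  intro x hx
  obtain ⟨l, rfl⟩ := exists_list_prod_eq x
  have hl : length (l.map (letter I)).prod = n := hx
  rw [length_prod] at hl
  exact ⟨⟨l, hl⟩, trivial, rfl⟩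

theorem growth_pos [Finite A] [Nonempty A] (n : ℕ) : 0 < growth I n := by
  rw [growth, Set.ncard_pos (finite_length_eq I n)]
  exact ⟨letter I (Classical.arbitrary A) ^ n, by
    induction n with
    | zero => simp
    | succ n ih => rw [Set.mem_ofPred_eq] at ih ⊢; rw [pow_succ]; simp [ih]⟩

theorem length_incl (H : Set A) (x : TraceMonoid (I.induce H)) :
    length (incl I H x) = length x := by
  induction x using letter_mul_induction with
  | one => simp
  | mul a x ih =>
    rw [map_mul, length_mul, length_mul, ih]
    rfl

theorem growth_induce (H : Set A) (n : ℕ) : growth (I.induce H) n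
    = {x | x ∈ Submonoid.closure (letter I '' H) ∧ length x = n}.ncard := by
  rw [growth, ← Set.ncard_image_of_injective _ (incl_injective I H), ← mrange_incl]
  congr 1
  ext x
  constructor
  · rintro ⟨x, rfl, rfl⟩
    exact ⟨⟨x, rfl⟩, length_incl I H x⟩
  · rintro ⟨⟨x, rfl⟩, hx⟩
    exact ⟨x, (length_incl I H x).symm.trans hx, rfl⟩

theorem growth_induce_le [Finite A] (H : Set A) (n : ℕ) : growth (I.induce H) n ≤ growth I n := by
  rw [growth_induce]
  exact Set.ncard_le_ncard (fun x hx => hx.2) (finite_length_eq I n)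

theorem growth_induce_mono [Finite A] {H K : Set A} (h : H ⊆ K) (n : ℕ) :
    growth (I.induce H) n ≤ growth (I.induce K) n := by
  rw [growth_induce, growth_induce]
  refine Set.ncard_le_ncard (fun x hx => ⟨?_, hx.2⟩)
    ((finite_length_eq I n).subset fun x hx => hx.2)
  exact Submonoid.closure_mono (Set.image_mono h) hx.1

end Growth

end TraceMonoid

/-! ### Nonnegative power series inverse to a polynomial -/

section InversePowerSeries

open FormalMultilinearSeries Filter Topology
open scoped NNReal ENNReal

variable {a : ℕ → ℝ} {p : Polynomial ℝ}

theorem tsum_mul_aeval_eq_one (h : PowerSeries.mk a * (p : PowerSeries ℝ) = 1) {z : ℂ}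
    (hz : Summable fun n => ‖(a n : ℂ) * z ^ n‖) :
    (∑' n, (a n : ℂ) * z ^ n) * Polynomial.aeval z p = 1 := by
  have h0 (n : ℕ) (hn : n ∉ Finset.range (p.natDegree + 1)) : (p.coeff n : ℂ) * z ^ n = 0 := by
    rw [Polynomial.coeff_eq_zero_of_natDegree_lt (by simpa using hn)]
    simp
  have hp : Polynomial.aeval z p = ∑' n, (p.coeff n : ℂ) * z ^ n := by
    rw [tsum_eq_sum h0, Polynomial.aeval_eq_sum_range]
    simp [Algebra.smul_def]
  have hps : Summable fun n => ‖(p.coeff n : ℂ) * z ^ n‖ :=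
    summable_of_ne_finset_zero (s := Finset.range (p.natDegree + 1)) fun n hn => by simp [h0 n hn]
  rw [hp, tsum_mul_tsum_eq_tsum_sum_antidiagonal_of_summable_norm hz hps]
  have hc (n : ℕ) : ∑ kl ∈ Finset.HasAntidiagonal.antidiagonal n,
      (a kl.1 : ℂ) * z ^ kl.1 * ((p.coeff kl.2 : ℂ) * z ^ kl.2) = if n = 0 then 1 else 0 := by
    have h1 := congrArg (PowerSeries.coeff n) h
    rw [PowerSeries.coeff_mul, PowerSeries.coeff_one] at h1
    simp only [PowerSeries.coeff_mk, Polynomial.coeff_coe] at h1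
    have h2 : ∑ kl ∈ Finset.HasAntidiagonal.antidiagonal n,
        (a kl.1 : ℂ) * z ^ kl.1 * ((p.coeff kl.2 : ℂ) * z ^ kl.2)
        = ((∑ kl ∈ Finset.HasAntidiagonal.antidiagonal n, a kl.1 * p.coeff kl.2 : ℝ) : ℂ) * z ^ n := by
      push_cast
      rw [Finset.sum_mul]
      refine Finset.sum_congr rfl fun kl hkl => ?_
      rw [← Finset.HasAntidiagonal.mem_antidiagonal.1 hkl, pow_add]
      ring
    rw [h2, h1]
    split_ifs with hn <;> simp [hn]
  simp_rw [hc]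
  exact tsum_ite_eq 0 _

theorem summable_norm_mul_pow_of_lt_radius {z : ℂ} (hz : (‖z‖₊ : ℝ≥0∞) < (ofScalars ℝ a).radius) :
    Summable fun n => ‖(a n : ℂ) * z ^ n‖ := by
  refine ((ofScalars ℝ a).summable_norm_mul_pow hz).congr fun n => ?_
  rw [ofScalars_norm, norm_mul, norm_pow, Complex.norm_real, coe_nnnorm]

/-- Here `p` is the inverse of the sum `G` of the series, and nonnegative coefficients give `|G(z)|
≤ G(|z|)`. -/
theorem eval_norm_pos_and_le (ha : ∀ n, 0 ≤ a n)
    (h : PowerSeries.mk a * (p : PowerSeries ℝ) = 1) {z : ℂ}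
    (hz : (‖z‖₊ : ℝ≥0∞) < (ofScalars ℝ a).radius) :
    0 < p.eval ‖z‖ ∧ p.eval ‖z‖ ≤ ‖Polynomial.aeval z p‖ := by
  have hs := summable_norm_mul_pow_of_lt_radius hz
  have h1 := tsum_mul_aeval_eq_one h hs
  have hz' : (‖((‖z‖ : ℝ) : ℂ)‖₊ : ℝ≥0∞) < (ofScalars ℝ a).radius := by
    simpa using hz
  have h2 := tsum_mul_aeval_eq_one h (summable_norm_mul_pow_of_lt_radius hz')
  have h3 : (∑' n, a n * ‖z‖ ^ n) * p.eval ‖z‖ = 1 := by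
    have : Polynomial.aeval ((‖z‖ : ℝ) : ℂ) p = ((p.eval ‖z‖ : ℝ) : ℂ) := by
      rw [← Complex.coe_algebraMap, Polynomial.aeval_algebraMap_apply, Polynomial.coe_aeval_eq_eval]
    rw [this] at h2
    exact_mod_cast h2
  have hg : 0 ≤ ∑' n, a n * ‖z‖ ^ n := tsum_nonneg fun n => mul_nonneg (ha n) (by positivity)
  have hle : ‖∑' n, (a n : ℂ) * z ^ n‖ ≤ ∑' n, a n * ‖z‖ ^ n := by
    refine (norm_tsum_le_tsum_norm hs).trans_eq (tsum_congr fun n => ?_)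
    rw [norm_mul, norm_pow, Complex.norm_real, Real.norm_of_nonneg (ha n)]
  have hpos : 0 < p.eval ‖z‖ := pos_of_mul_pos_right (h3 ▸ one_pos) hg
  refine ⟨hpos, ?_⟩
  have hn : ‖∑' n, (a n : ℂ) * z ^ n‖ * ‖Polynomial.aeval z p‖ = 1 := by
    rw [← norm_mul, h1, norm_one]
  have hg' : 0 < ∑' n, a n * ‖z‖ ^ n := pos_of_mul_pos_left (h3 ▸ one_pos) hpos.le
  refine le_of_mul_le_mul_left ?_ hg'
  rw [h3, ← hn]
  gcongr

/-- On the boundary circle the series need not converge, but both bounds survive the limit `t → 1⁻`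
along `t * z`, as `p` is continuous. -/
theorem eval_norm_nonneg_and_le (ha : ∀ n, 0 ≤ a n)
    (h : PowerSeries.mk a * (p : PowerSeries ℝ) = 1) (h0 : 0 < (ofScalars ℝ a).radius) {z : ℂ}
    (hz : (‖z‖₊ : ℝ≥0∞) ≤ (ofScalars ℝ a).radius) :
    0 ≤ p.eval ‖z‖ ∧ p.eval ‖z‖ ≤ ‖Polynomial.aeval z p‖ := by
  have ht (t : ℝ) (ht : t ∈ Set.Ioo (0 : ℝ) 1) : 0 < p.eval ‖t * z‖ ∧
      p.eval ‖t * z‖ ≤ ‖Polynomial.aeval (t * z) p‖ := by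
    refine eval_norm_pos_and_le ha h ?_
    rcases eq_or_ne z 0 with rfl | hz0
    · simpa using h0
    · refine lt_of_lt_of_le ?_ hz
      rw [ENNReal.coe_lt_coe, ← NNReal.coe_lt_coe, coe_nnnorm, coe_nnnorm, norm_mul,
        Complex.norm_real, Real.norm_of_nonneg ht.1.le]
      exact mul_lt_of_lt_one_left (norm_pos_iff.2 hz0) ht.2
  have hev : ∀ᶠ t : ℝ in 𝓝[<] 1, t ∈ Set.Ioo (0 : ℝ) 1 := Ioo_mem_nhdsLT one_pos
  have hc1 : Continuous fun t : ℝ => p.eval ‖t * z‖ := by fun_prop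
  have hc2 : Continuous fun t : ℝ => ‖Polynomial.aeval (t * z) p‖ := by fun_prop
  have l1 := (hc1.tendsto 1).mono_left (nhdsWithin_le_nhds (s := Set.Iio 1))
  have l2 := (hc2.tendsto 1).mono_left (nhdsWithin_le_nhds (s := Set.Iio 1))
  simp only [Complex.ofReal_one, one_mul] at l1 l2
  exact ⟨ge_of_tendsto l1 (hev.mono fun t h => (ht t h).1.le),
    le_of_tendsto_of_tendsto l1 l2 (hev.mono fun t h => (ht t h).2)⟩

/-- If no zero of `p` has norm at most `ρ`, then the same is true for some larger radius. -/
theorem exists_gt_forall_aeval_ne_zero (hp : p ≠ 0) {ρ : ℝ≥0}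
    (h : ∀ z : ℂ, ‖z‖₊ ≤ ρ → Polynomial.aeval z p ≠ 0) :
    ∃ σ, ρ < σ ∧ ∀ z : ℂ, ‖z‖₊ ≤ σ → Polynomial.aeval z p ≠ 0 := by
  classical
  have hev (w : ℂ) (hw : w ∈ p.aroots ℂ) : ∀ᶠ σ in 𝓝[>] ρ, σ < ‖w‖₊ := by
    have : ρ < ‖w‖₊ := by
      by_contra! hle
      exact h w hle ((Polynomial.mem_aroots.1 hw).2)
    exact mem_nhdsWithin_of_mem_nhds (Iio_mem_nhds this)
  have hall : ∀ᶠ σ in 𝓝[>] ρ, ∀ w ∈ (p.aroots ℂ).toFinset, σ < ‖w‖₊ :=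
    (Filter.eventually_all_finset _).2 fun w hw => hev w (by simpa using hw)
  obtain ⟨σ, hσ, hρ⟩ := (hall.and self_mem_nhdsWithin).exists
  refine ⟨σ, hρ, fun z hz hz0 => ?_⟩
  exact (hσ z (by rw [Multiset.mem_toFinset, Polynomial.mem_aroots]; exact ⟨hp, hz0⟩)).not_ge hz

/-- The function `1 / p` is holomorphic on the closed disc of radius `σ`, so its Cauchy series
converges on the open one; by uniqueness of expansions at `0` that series is the given one. -/
theorem le_radius_of_forall_aeval_ne_zero
    (h : PowerSeries.mk a * (p : PowerSeries ℝ) = 1) (h0 : 0 < (ofScalars ℝ a).radius) {σ : ℝ≥0}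
    (hσ0 : 0 < σ) (hσ : ∀ z : ℂ, ‖z‖₊ ≤ σ → Polynomial.aeval z p ≠ 0) :
    σ ≤ (ofScalars ℝ a).radius := by
  have hd : DifferentiableOn ℂ (fun z : ℂ => (Polynomial.aeval z p)⁻¹) (Metric.closedBall 0 σ) := by
    intro z hz
    refine DifferentiableAt.differentiableWithinAt (DifferentiableAt.inv ?_ (hσ z ?_))
    · exact (Polynomial.differentiable_aeval p).differentiableAt
    · simpa [← NNReal.coe_le_coe] using hz
  have hq := hd.hasFPowerSeriesOnBall hσ0
  have hnorm (n : ℕ) : ‖ofScalars ℂ (fun n => (a n : ℂ)) n‖ = ‖ofScalars ℝ a n‖ := by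
    rw [ofScalars_norm, ofScalars_norm, Complex.norm_real]
  have hrad : (ofScalars ℂ fun n => (a n : ℂ)).radius = (ofScalars ℝ a).radius := by
    simp only [FormalMultilinearSeries.radius, hnorm]
  have hG : HasFPowerSeriesOnBall (fun z : ℂ => (Polynomial.aeval z p)⁻¹)
      (ofScalars ℂ fun n => (a n : ℂ)) 0 (ofScalars ℝ a).radius := by
    have hG := (ofScalars ℂ fun n => (a n : ℂ)).hasFPowerSeriesOnBall (hrad ▸ h0)
    rw [hrad] at hG
    refine hG.congr fun z hz => ?_
    have hz' : (‖z‖₊ : ℝ≥0∞) < (ofScalars ℝ a).radius := by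
      simpa [edist_zero_right, enorm_eq_nnnorm] using hz
    have := tsum_mul_aeval_eq_one h (summable_norm_mul_pow_of_lt_radius hz')
    change ofScalarsSum _ z = _
    rw [ofScalarsSum_eq_tsum]
    simp only [smul_eq_mul]
    exact eq_inv_of_mul_eq_one_left this
  have heq := hq.hasFPowerSeriesAt.eq_formalMultilinearSeries hG.hasFPowerSeriesAt
  rw [heq] at hq
  exact hrad ▸ hq.r_le

/-- A power series with nonnegative coefficients that is the inverse of a polynomial: its radius of
convergence, if finite, is a root of the polynomial. -/
theorem eval_radius_eq_zero (ha : ∀ n, 0 ≤ a n)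
    (h : PowerSeries.mk a * (p : PowerSeries ℝ) = 1) (h0 : 0 < (ofScalars ℝ a).radius)
    (htop : (ofScalars ℝ a).radius ≠ ⊤) : p.eval (ofScalars ℝ a).radius.toReal = 0 := by
  obtain ⟨ρ, hρ⟩ := WithTop.ne_top_iff_exists.1 htop
  replace hρ : (ρ : ℝ≥0∞) = (ofScalars ℝ a).radius := hρ
  rw [← hρ, ENNReal.coe_toReal]
  have hx := (eval_norm_nonneg_and_le ha h h0 (z := ((ρ : ℝ) : ℂ)) (by simp [← hρ])).1
  rw [Complex.norm_real, NNReal.norm_eq] at hx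
  -- If `p` is positive at `ρ`, then `|p(z)| ≥ p(|z|) > 0` on the whole closed disc, so `1 / p` is
  -- holomorphic on a larger disc and the radius would exceed `ρ`.
  by_contra hne
  have hpos : 0 < p.eval (ρ : ℝ) := lt_of_le_of_ne hx (Ne.symm hne)
  have hp : p ≠ 0 := by
    rintro rfl
    simp at hne
  obtain ⟨σ, hσ, hσ'⟩ := exists_gt_forall_aeval_ne_zero hp (ρ := ρ) fun z hz hz0 => by
    have h1 := (eval_norm_nonneg_and_le ha h h0 (z := z) (by rw [← hρ]; exact_mod_cast hz)).2
    rw [hz0, norm_zero] at h1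
    refine h1.not_gt ?_
    rcases hz.lt_or_eq with hlt | heq
    · exact (eval_norm_pos_and_le ha h (by rw [← hρ]; exact_mod_cast hlt)).1
    · rwa [← coe_nnnorm, heq]
  have := le_radius_of_forall_aeval_ne_zero h h0 (bot_le.trans_lt hσ) hσ'
  rw [← hρ] at this
  exact (ENNReal.coe_le_coe.1 this).not_gt hσ

end InversePowerSeries

namespace TraceMonoid

/-! ### Characteristic roots and values of Möbius polynomials -/

section CharRoot

open scoped ENNReal NNReal

variable {A : Type*} (I : SimpleGraph A)

theorem charRoot_eq_radius : charRoot I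
    = (FormalMultilinearSeries.ofScalars ℝ fun n => (growth I n : ℝ)).radius := by
  rw [charRoot, ConcurrentSystem.charRoot, iInf_unique, iInf_unique, ConcurrentSystem.growthRadius]
  have h (n : ℕ) : ((toSystem I).executions () () n).ncard = growth I n := by
    rw [growth]
    congr 1
    ext x
    exact ⟨fun hx => hx.2, fun hx => ⟨rfl, hx⟩⟩
  congr
  funext n
  exact congrArg _ (h n)

variable {I} in
theorem charRoot_le_of_growth_le {B : Type*} {J : SimpleGraph B}
    (h : ∀ n, growth J n ≤ growth I n) : charRoot I ≤ charRoot J := by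
  rw [charRoot_eq_radius, charRoot_eq_radius]
  refine FormalMultilinearSeries.radius_le_of_le fun n => ?_
  rw [FormalMultilinearSeries.ofScalars_norm, FormalMultilinearSeries.ofScalars_norm]
  simpa using h n

variable [Finite A]

theorem charRoot_le_induce (H : Set A) : charRoot I ≤ charRoot (I.induce H) :=
  charRoot_le_of_growth_le (growth_induce_le I H)

theorem charRoot_induce_anti {H K : Set A} (h : H ⊆ K) :
    charRoot (I.induce K) ≤ charRoot (I.induce H) :=
  charRoot_le_of_growth_le (growth_induce_mono I h)

theorem charRoot_pos : 0 < charRoot I := by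
  have := Fintype.ofFinite A
  -- Adding `1` to the growth rate keeps `c` positive when the alphabet is empty.
  let c : ℝ≥0 := (Fintype.card A + 1)⁻¹
  have hc : 0 < c := by positivity
  refine lt_of_lt_of_le (ENNReal.coe_pos.2 hc) ?_
  rw [charRoot_eq_radius]
  refine FormalMultilinearSeries.le_radius_of_bound _ 1 fun n => ?_
  rw [FormalMultilinearSeries.ofScalars_norm, RCLike.norm_natCast]
  have h1 : (growth I n : ℝ) ≤ ((Fintype.card A : ℝ) + 1) ^ n := by
    calc (growth I n : ℝ) ≤ (Fintype.card A : ℝ) ^ n := by exact_mod_cast growth_le I n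
      _ ≤ _ := by gcongr; linarith
  have h2 : ((c : ℝ≥0) : ℝ) = ((Fintype.card A : ℝ) + 1)⁻¹ := by simp [c]
  rw [h2, inv_pow]
  exact mul_inv_le_one_of_le₀ h1 (by positivity)

/-- There is a trace of every length, so the terms of the series at `z = 1` are at least `1`. -/
theorem charRoot_le_one [Nonempty A] : charRoot I ≤ 1 := by
  by_contra! h
  rw [charRoot_eq_radius, ← ENNReal.coe_one] at h
  have := (FormalMultilinearSeries.summable_norm_mul_pow _ h).tendsto_atTop_zero
  have hlt := this.eventually_lt_const one_pos
  obtain ⟨n, hn⟩ := hlt.exists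
  rw [FormalMultilinearSeries.ofScalars_norm, RCLike.norm_natCast] at hn
  have hg := growth_pos I n
  simp at hn
  omega

theorem charRoot_ne_top [Nonempty A] : charRoot I ≠ ⊤ :=
  ne_top_of_le_ne_top ENNReal.one_ne_top (charRoot_le_one I)

theorem moebius_eval_pos {x : ℝ≥0} (hx : x < charRoot I) : 0 < (moebius I).eval (x : ℝ) := by
  rw [charRoot_eq_radius] at hx
  have := (eval_norm_pos_and_le (fun n => Nat.cast_nonneg _) (growth_mul_moebius I)
    (z := ((x : ℝ) : ℂ)) (by simpa using hx)).1
  simpa using this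

theorem moebius_eval_nonneg {x : ℝ≥0} (hx : x ≤ charRoot I) : 0 ≤ (moebius I).eval (x : ℝ) := by
  have h0 := charRoot_pos I
  rw [charRoot_eq_radius] at hx h0
  have := (eval_norm_nonneg_and_le (fun n => Nat.cast_nonneg _) (growth_mul_moebius I) h0
    (z := ((x : ℝ) : ℂ)) (by simpa using hx)).1
  simpa using this

theorem moebius_eval_charRoot (h : charRoot I ≠ ⊤) : (moebius I).eval (charRoot I).toReal = 0 := by
  have h0 := charRoot_pos I
  rw [charRoot_eq_radius] at h h0 ⊢
  exact eval_radius_eq_zero (fun n => Nat.cast_nonneg _) (growth_mul_moebius I) h0 h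

theorem charRoot_lt_induce_iff [Nonempty A] (H : Set A) :
    charRoot I < charRoot (I.induce H) ↔ 0 < (moebius (I.induce H)).eval (charRoot I).toReal := by
  have htop := charRoot_ne_top I
  constructor
  · intro h
    refine moebius_eval_pos (I.induce H) (x := (charRoot I).toNNReal) ?_
    rwa [ENNReal.coe_toNNReal htop]
  · intro h
    refine lt_of_le_of_ne (charRoot_le_induce I H) fun heq => h.ne' ?_
    rw [heq] at htop ⊢
    exact moebius_eval_charRoot _ htop

/-! ### Irreducibility and the spectral property -/

theorem cliquePoly_eval_charRoot_nonneg [Nonempty A] (s : Finset A) :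
    0 ≤ (cliquePoly I s).eval (charRoot I).toReal := by
  rw [← moebius_induce (s : Set A) rfl]
  refine moebius_eval_nonneg (I.induce (s : Set A)) (x := (charRoot I).toNNReal) ?_
  rw [ENNReal.coe_toNNReal (charRoot_ne_top I)]
  exact charRoot_le_induce I _

theorem cliquePoly_univ_eval_charRoot [Fintype A] [Nonempty A] :
    (cliquePoly I Finset.univ).eval (charRoot I).toReal = 0 := by
  rw [← moebius_eq_cliquePoly]
  exact moebius_eval_charRoot I (charRoot_ne_top I)

/-- The letters of a minimal sub-alphabet at which the Möbius polynomial vanishes commute with all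
other letters. -/
theorem adj_of_minimal [Nonempty A] {s : Finset A}
    (hs : Minimal (fun s => (cliquePoly I s).eval (charRoot I).toReal = 0) s) {a b : A}
    (ha : a ∈ s) (hb : b ∉ s) : I.Adj b a := by
  classical
  -- With `r` the characteristic root, the recursion turns this into `0 ≤ -r μ_{s ∩ I(b)}(r)`, whose
  -- polynomial is also nonnegative at `r > 0`.
  have h1 := cliquePoly_eval_charRoot_nonneg I (insert b s)
  rw [cliquePoly_insert hb, Polynomial.eval_sub, hs.prop, Polynomial.eval_mul, Polynomial.eval_X,
    zero_sub] at h1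
  have hr : 0 < (charRoot I).toReal := ENNReal.toReal_pos (charRoot_pos I).ne' (charRoot_ne_top I)
  have h2 := cliquePoly_eval_charRoot_nonneg I (s.filter (I.Adj b))
  have h3 : (cliquePoly I (s.filter (I.Adj b))).eval (charRoot I).toReal = 0 := by
    refine le_antisymm ?_ h2
    by_contra! hpos
    linarith [mul_pos hr hpos]
  exact (Finset.mem_filter.1 (hs.le_of_le h3 (Finset.filter_subset _ _) ha)).2

theorem spectralProperty_of_isIrreducible (h : IsIrreducible I) :
    (toSystem I).SpectralProperty := by
  classical
  have := Fintype.ofFinite A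
  intro a
  have : Nonempty A := ⟨a⟩
  change charRoot I < charRoot (I.induce {b | b ≠ a})
  have ht : ((Finset.univ.erase a : Finset A) : Set A) = {b | b ≠ a} := by ext; simp
  rw [charRoot_lt_induce_iff, moebius_induce _ ht]
  refine lt_of_le_of_ne (cliquePoly_eval_charRoot_nonneg I _) fun h0 => ?_
  obtain ⟨s, hsa, hs⟩ := exists_minimal_le_of_wellFoundedLT
    (fun s => (cliquePoly I s).eval (charRoot I).toReal = 0) _ h0.symm
  have hne : s.Nonempty := by
    rw [Finset.nonempty_iff_ne_empty]
    rintro rfl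
    simpa [cliquePoly_empty] using hs.prop
  obtain ⟨b, hb⟩ := hne
  have ha : a ∉ s := fun ha => by simpa using hsa ha
  -- A walk in the dependence graph from `b ∈ s` to `a ∉ s` must leave `s` along some edge, whose
  -- ends would have to be independent.
  obtain ⟨w⟩ := h b a
  obtain ⟨d, -, hd1, hd2⟩ := w.exists_boundary_dart (s : Set A) hb ha
  exact ((SimpleGraph.compl_adj _ _ _).1 d.adj).2 (adj_of_minimal I hs hd1 hd2).symm

theorem isIrreducible_of_spectralProperty (h : (toSystem I).SpectralProperty) :
    IsIrreducible I := by
  classical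
  have := Fintype.ofFinite A
  intro a b
  by_contra hab
  have : Nonempty A := ⟨a⟩
  -- By the spectral property and monotonicity every proper sub-alphabet has a strictly larger root,
  -- so its polynomial is positive at `r`.
  have hpos (s : Finset A) (c : A) (hc : c ∉ s) :
      (cliquePoly I s).eval (charRoot I).toReal ≠ 0 := by
    intro h0
    have h1 : charRoot I < charRoot (I.induce (s : Set A)) := by
      refine lt_of_lt_of_le (h c) (charRoot_induce_anti I ?_)
      rintro d hd rfl
      exact hc hd
    rw [charRoot_lt_induce_iff, moebius_induce (s : Set A) rfl, h0] at h1
    exact h1.false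
  -- The dependence component of `a` contains `a` but not `b`, so it and its complement are both
  -- proper, and they are mutually independent.
  let s : Finset A := {c | Iᶜ.Reachable a c}
  have hu := cliquePoly_univ_eval_charRoot I
  have hadj : ∀ c ∈ s, ∀ d ∈ sᶜ, I.Adj c d := by
    intro c hc d hd
    simp only [s, Finset.mem_filter, Finset.mem_univ, true_and, Finset.mem_compl] at hc hd
    by_contra hcd
    refine hd (hc.trans (SimpleGraph.Adj.reachable ((SimpleGraph.compl_adj _ _ _).2 ⟨?_, hcd⟩)))
    rintro rfl
    exact hd hc
  rw [← Finset.union_compl s, cliquePoly_union hadj, Polynomial.eval_mul, mul_eq_zero] at hu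
  rcases hu with hu | hu
  · exact hpos s b (by simpa [s] using hab) hu
  · exact hpos sᶜ a (by simp [s]) hu

end CharRoot

end TraceMonoid

theorem mainTheorem7 {A : Type*} [Finite A] (I : SimpleGraph A) :
    (∀ H : Set A,
      TraceMonoid.charRoot I ≤ TraceMonoid.charRoot (I.induce H) ∧
      (Nonempty A →
        TraceMonoid.charRoot I ≠ ⊤ ∧
        (TraceMonoid.charRoot I < TraceMonoid.charRoot (I.induce H) ↔
          0 < (TraceMonoid.moebius (I.induce H)).eval (TraceMonoid.charRoot I).toReal))) ∧
    ((TraceMonoid.toSystem I).SpectralProperty ↔ TraceMonoid.IsIrreducible I) := by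
  refine ⟨fun H => ⟨TraceMonoid.charRoot_le_induce I H, fun _ =>
    ⟨TraceMonoid.charRoot_ne_top I, TraceMonoid.charRoot_lt_induce_iff I H⟩⟩,
    TraceMonoid.isIrreducible_of_spectralProperty I, TraceMonoid.spectralProperty_of_isIrreducible I⟩
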